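/- For integers $A,B$ let $u_0(A,B)=0$, $u_1(A,B)=1$ and $u_{k+1}(A,B)=A\,u_k(A,B)-B\,u_{k-1}(A,B)$ for $k\ge 1$. Let $C_k=\binom{2k}{k}-\binom{2k}{k+1}=\frac{1}{k+1}\binom{2k}{k}$ denote the $k$-th Catalan number, and let $\left(\frac{\cdot}{p}\right)$ denote the Legendre symbol. For rational numbers $a,b$, the congruence $a\equiv b\pmod{p^2}$ means that $a,b\in\mathbb Z_p$ and $a-b\in p^2\mathbb Z_p$, where $\mathbb Z_p$ is the ring of $p$-adic integers. **Theorem 1.1.** Let $m$ be a nonzero integer, $n$ a positive integer, and $\Delta=m(m-4)$. For any odd prime $p$ not dividing $m$ we have $$\frac1n\left(\sum_{k=0}^{pn-1}\frac{\binom{2k}{k}}{m^k}-\left(\frac{\Delta}{p}\right)\sum_{r=0}^{n-1}\frac{\binom{2r}{r}}{m^r}\right)\equiv\frac{\binom{2n-1}{n-1}}{m^{n-1}}\,u_{p-\left(\frac{\Delta}{p}\right)}(m-2,1)\pmod{p^2},\tag{1.5}$$ $$\frac1n\left(\sum_{k=0}^{pn-1}\frac{\binom{2k}{k+1}}{m^k}-\left(\frac{\Delta}{p}\right)\sum_{r=0}^{n-1}\frac{\binom{2r}{r+1}}{m^r}+\left(\frac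 m2-\frac{\binom{2n-1}{n-1}}{m^{n-1}}\right)\left(1-\left(\frac{\Delta}{p}\right)\right)\right)\equiv\frac{\binom{2n-1}{n-1}}{m^{n-1}}\left(1-m^{p-1}+\frac{m-2}{2}\,u_{p-\left(\frac{\Delta}{p}\right)}(m-2,1)\right)\pmod{p^2},\tag{1.6}$$ and hence $$\frac1n\left(\sum_{k=0}^{pn-1}\frac{C_k}{m^k}-\left(\frac{\Delta}{p}\right)\sum_{r=0}^{n-1}\frac{C_r}{m^r}+\left(\frac{\binom{2n-1}{n-1}}{m^{n-1}}-\frac m2\right)\left(1-\left(\frac{\Delta}{p}\right)\right)\right)\equiv\frac{\binom{2n-1}{n-1}}{m^{n-1}}\left(m^{p-1}-1+\frac{4-m}{2}\,u_{p-\left(\frac{\Delta}{p}\right)}(m-2,1)\right)\pmod{p^2}.\tag{1.7}$$ -/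

import Mathlib

/-- The Lucas sequence `u_n(A, B)`: `u_0 = 0`, `u_1 = 1`, `u_{n+1} = A u_n - B u_{n-1}`. -/
def lucasU (A B : ℤ) : ℕ → ℤ
  | 0 => 0
  | 1 => 1
  | n + 2 => A * lucasU A B (n + 1) - B * lucasU A B n

/-- `a ≡ b (mod p ^ e)` for rational numbers `a` and `b`: both are `p`-adic integers, and
`p ^ e` divides their difference in the ring `ℤ_[p]` of `p`-adic integers. -/
def PadicModEq (p : ℕ) [Fact p.Prime] (e : ℕ) (a b : ℚ) : Prop :=
  ∃ x y : ℤ_[p], (x : ℚ_[p]) = (a : ℚ_[p]) ∧ (y : ℚ_[p]) = (b : ℚ_[p]) ∧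
    (p : ℤ_[p]) ^ e ∣ x - y

/-! Put `x = m - 2`, let `α` be a root of `T² - xT + 1`, and let `u`, `v` be its Lucas sequences, so
that `(1 + α)² = mα`. Clearing powers of `m` turns the first sum into `G N = ∑ k < N, C(2k,k)
m^(N-1-k)`, and `centralSum_eq_sum` gives `G N = ∑ l, C(2N, N+l) u_l`. Dividing by `n`, which `p`
may divide, forces every congruence to hold modulo `n p²`.

For `N = pn`, expand `(1 + X)^(2pn)` to first order around `(1 + X^p)^(2n)`; the remainder is
divisible by `n p²` because `p` is odd. With `e` the Legendre symbol and `k = p - e`, two terms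
remain: - `∑ C(2n, n+l) u_{pl}`, where `2u_{pl} ≡ 2e u_l + l u_k v_l` modulo `l p²`, since `α^k ≡ 1`
modulo `p`; the factor `l` becomes a factor `n` through `l C(2n, n+l) = n (C(2n-1, n+l-1) - C(2n-1,
n+l))`; - a deviation term governed by `(1 + α)^p - 1 - α^p`, needed only modulo `p²`
(`IsLucasRank.deviation`).

The multiples of `u_k G n` cancel, leaving `G (pn) ≡ m^((p-1)n) (e G n + n C(2n-1, n-1) u_k)`
(`IsLucasRank.dvd_centralSum_prime_mul`). The sum of `C(2k, k+1)/m^k` reduces to the first sum by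
telescoping, plus the congruence `C(2pn, pn) ≡ C(2n, n)` modulo `n p²`. The Catalan case is the
difference of the two. -/

open Finset QuadraticAlgebra

/-! ### Lucas sequences and binomial expansions of the central sums -/

section LucasSequences

variable {A : Type*} [CommRing A]

/-- The canonical root of `T ^ 2 - x T + 1`. -/
def lucasRoot (x : A) : QuadraticAlgebra A (-1) x := omega

/-- The Lucas sequence `u_l(x, 1)`, as the `ω`-coordinate of the powers of `lucasRoot x`. -/
def lucasIm (x : A) (l : ℕ) : A := (lucasRoot x ^ l).im

/-- The companion Lucas sequence `v_l(x, 1)`. -/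
def lucasTrace (x : A) (l : ℕ) : A := trace (lucasRoot x ^ l)

/-- `centralSum m N = ∑ k < N, C(2k, k) m ^ (N - 1 - k)`. -/
def centralSum (m : A) : ℕ → A
  | 0 => 0
  | N + 1 => m * centralSum m N + ((2 * N).choose N : A)

@[simp] lemma lucasIm_zero (x : A) : lucasIm x 0 = 0 := by simp [lucasIm, im_one]

@[simp] lemma lucasIm_one (x : A) : lucasIm x 1 = 1 := by simp [lucasIm, lucasRoot]

@[simp] lemma lucasTrace_zero (x : A) : lucasTrace x 0 = 2 := by simp [lucasTrace]

@[simp] lemma lucasTrace_one (x : A) : lucasTrace x 1 = x := by simp [lucasTrace, lucasRoot]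

/-- The coordinates (trace, `im`) represent `z` as `(trace z + im z · √(x² - 4)) / 2`. The product
rules are stated doubled so that they hold without inverting 2. -/
lemma two_mul_im_mul {x : A} (z w : QuadraticAlgebra A (-1) x) :
    2 * (z * w).im = z.im * trace w + trace z * w.im := by
  simp only [im_mul, trace_def]; ring

lemma two_mul_trace_mul {x : A} (z w : QuadraticAlgebra A (-1) x) :
    2 * trace (z * w) = trace z * trace w + (x ^ 2 - 4) * (z.im * w.im) := by
  simp only [im_mul, re_mul, trace_def]; ring

lemma trace_sq_sub {x : A} (z : QuadraticAlgebra A (-1) x) :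
    trace z ^ 2 - (x ^ 2 - 4) * z.im ^ 2 = 4 * norm z := by
  simp only [trace_def, norm_def]; ring

lemma norm_lucasRoot (x : A) : norm (lucasRoot x) = 1 := by
  simp [norm_def, lucasRoot]

lemma two_mul_lucasIm_succ (x : A) (l : ℕ) :
    2 * lucasIm x (l + 1) = x * lucasIm x l + lucasTrace x l := by
  simp only [lucasIm, lucasTrace, pow_succ, im_mul, trace_def, lucasRoot, omega_re, omega_im]; ring

lemma two_mul_lucasTrace_succ (x : A) (l : ℕ) :
    2 * lucasTrace x (l + 1) = x * lucasTrace x l + (x ^ 2 - 4) * lucasIm x l := by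
  simp only [lucasIm, lucasTrace, pow_succ, im_mul, re_mul, trace_def, lucasRoot, omega_re,
    omega_im]
  ring

lemma two_mul_lucasIm_eq_succ (x : A) (l : ℕ) :
    2 * lucasIm x l = x * lucasIm x (l + 1) - lucasTrace x (l + 1) := by
  simp only [lucasIm, lucasTrace, pow_succ, im_mul, re_mul, trace_def, lucasRoot, omega_re,
    omega_im]
  ring

lemma two_mul_lucasTrace_eq_succ (x : A) (l : ℕ) :
    2 * lucasTrace x l = x * lucasTrace x (l + 1) - (x ^ 2 - 4) * lucasIm x (l + 1) := by
  simp only [lucasIm, lucasTrace, pow_succ, im_mul, re_mul, trace_def, lucasRoot, omega_re,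
    omega_im]
  ring

lemma lucasTrace_succ_sub (x : A) (l : ℕ) :
    lucasTrace x (l + 1) - lucasTrace x l = (x - 2) * (lucasIm x (l + 1) + lucasIm x l) := by
  simp only [lucasIm, lucasTrace, pow_succ, im_mul, re_mul, trace_def, lucasRoot, omega_re,
    omega_im]
  ring

lemma lucasRoot_mul_star (x : A) : lucasRoot x * star (lucasRoot x) = 1 := by
  rw [← algebraMap_norm_eq_mul_star, norm_lucasRoot, map_one]

lemma lucasIm_add_two (x : A) (l : ℕ) :
    lucasIm x (l + 2) = x * lucasIm x (l + 1) - lucasIm x l := by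
  simp only [lucasIm, pow_succ, im_mul, re_mul, lucasRoot, omega_re, omega_im]; ring

lemma lucasTrace_add_two (x : A) (l : ℕ) :
    lucasTrace x (l + 2) = x * lucasTrace x (l + 1) - lucasTrace x l := by
  simp only [lucasTrace, trace_def, pow_succ, im_mul, re_mul, lucasRoot, omega_re, omega_im]; ring

lemma lucasU_cast (x : ℤ) : ∀ l : ℕ, (lucasU x 1 l : A) = lucasIm (x : A) l
  | 0 => by simp [lucasU]
  | 1 => by simp [lucasU]
  | l + 2 => by
    rw [lucasIm_add_two, ← lucasU_cast x l, ← lucasU_cast x (l + 1), lucasU]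
    push_cast; ring

lemma trace_sq_sub_lucas (x : A) (l : ℕ) :
    lucasTrace x l ^ 2 - (x ^ 2 - 4) * lucasIm x l ^ 2 = 4 := by
  simp only [lucasTrace, lucasIm, trace_sq_sub, map_pow, norm_lucasRoot]; simp

lemma sum_second_difference_mul_lucasIm (x : A) (c : ℕ → A) (K : ℕ) :
    ∑ l ∈ range K, (c (l + 2) + 2 * c (l + 1) + c l) * lucasIm x (l + 1) =
      (x + 2) * ∑ l ∈ range K, c l * lucasIm x l + c 0
        + c K * ((x + 2) * lucasIm x K - lucasIm x (K + 1)) + c (K + 1) * lucasIm x K := by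
  induction K with
  | zero => simp
  | succ K ih =>
    rw [sum_range_succ, sum_range_succ, ih, lucasIm_add_two]; ring

lemma sum_difference_mul_lucasTrace (x : A) (d : ℕ → A) (K : ℕ) :
    ∑ l ∈ range K, (d l - d (l + 1)) * lucasTrace x l =
      2 * d 0 + (x - 2) * ∑ l ∈ range K, (d l + d (l + 1)) * lucasIm x l
        - d K * (lucasTrace x K - (x - 2) * lucasIm x K) := by
  induction K with
  | zero => simp; ring
  | succ K ih =>
    rw [sum_range_succ, sum_range_succ, ih]
    linear_combination d (K + 1) * lucasTrace_succ_sub x K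

lemma two_mul_sum_add_mul_lucasIm (x : A) (d : ℕ → A) (K : ℕ) :
    2 * ∑ l ∈ range K, (d l + d (l + 1)) * lucasIm x l =
      (x + 2) * ∑ l ∈ range K, d (l + 1) * lucasIm x l
        + ∑ l ∈ range K, d (l + 1) * lucasTrace x l - 2 * d K * lucasIm x K := by
  induction K with
  | zero => simp
  | succ K ih =>
    rw [sum_range_succ, sum_range_succ, sum_range_succ, mul_add, ih]
    linear_combination d (K + 1) * two_mul_lucasIm_succ x K

/-- Two Pascal steps make row `2N + 2` a second difference of row `2N`. Summation by parts moves it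
onto `u`, where `u_{l+2} + 2u_{l+1} + u_l = (x + 2) u_{l+1}`; the boundary term `C(2N, N)` then
reproduces the recursion of `centralSum`. -/
lemma centralSum_eq_sum (x : A) (N : ℕ) :
    centralSum (x + 2) N = ∑ l ∈ range (N + 1), ((2 * N).choose (N + l) : A) * lucasIm x l := by
  induction N with
  | zero => simp [centralSum]
  | succ N ih =>
    have h := sum_second_difference_mul_lucasIm x (fun l => ((2 * N).choose (N + l) : A)) (N + 1)
    have e : ∀ l, ((2 * (N + 1)).choose (N + 1 + (l + 1)) : A) =
        ((2 * N).choose (N + (l + 2)) : A) + 2 * ((2 * N).choose (N + (l + 1)) : A)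
          + ((2 * N).choose (N + l) : A) := by
      intro l
      rw [show 2 * (N + 1) = 2 * N + 1 + 1 by ring, show N + 1 + (l + 1) = N + l + 1 + 1 by ring,
        Nat.choose_succ_succ', Nat.choose_succ_succ', Nat.choose_succ_succ' (2 * N) (N + l + 1)]
      push_cast; simp only [← add_assoc]; ring
    rw [sum_range_succ', lucasIm_zero, mul_zero, add_zero]
    simp only [e]
    rw [h, ← ih, centralSum, Nat.choose_eq_zero_of_lt (show 2 * N < N + (N + 1) by lia),
      Nat.choose_eq_zero_of_lt (show 2 * N < N + (N + 1 + 1) by lia)]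
    simp

lemma choose_two_mul_succ_cast (N l : ℕ) : ((2 * (N + 1)).choose (N + 1 + l) : A) =
    ((2 * N + 1).choose (N + l) : A) + ((2 * N + 1).choose (N + (l + 1)) : A) := by
  rw [show 2 * (N + 1) = 2 * N + 1 + 1 by ring, show N + 1 + l = N + l + 1 by ring,
    Nat.choose_succ_succ']
  push_cast; simp only [← add_assoc]

lemma choose_middle_eq (N : ℕ) : (2 * N + 1).choose (N + 1) = (2 * N + 1).choose N := by
  rw [← Nat.choose_symm (show N ≤ 2 * N + 1 by lia), show 2 * N + 1 - N = N + 1 by lia]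

/-- Trades the weight `l` for a factor `N + 1`; this is what upgrades error terms from `l p²` to `n
p²`. -/
lemma choose_two_mul_succ_mul (N l : ℕ) : ((2 * (N + 1)).choose (N + 1 + l) : A) * l =
    (N + 1 : ℕ) *
      (((2 * N + 1).choose (N + l) : A) - ((2 * N + 1).choose (N + (l + 1)) : A)) := by
  rw [choose_two_mul_succ_cast]
  rcases le_or_gt l (N + 1) with h | h
  · have := Nat.choose_succ_right_eq (2 * N + 1) (N + l)
    rw [show 2 * N + 1 - (N + l) = N + 1 - l by lia] at this
    have := congrArg (Nat.cast (R := A)) this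
    push_cast [Nat.cast_sub h] at this ⊢
    rw [← add_assoc N l 1]
    linear_combination this
  · rw [Nat.choose_eq_zero_of_lt (show 2 * N + 1 < N + l by lia),
      Nat.choose_eq_zero_of_lt (show 2 * N + 1 < N + (l + 1) by lia)]
    simp

lemma sum_choose_mul_lucasTrace (x : A) (n : ℕ) :
    ∑ l ∈ range (n + 1), ((2 * n).choose (n + l) : A) * (l * lucasTrace x l) =
      n * (((2 * n).choose n : A) + (x - 2) * centralSum (x + 2) n) := by
  cases n with
  | zero => simp
  | succ N =>
    have h := sum_difference_mul_lucasTrace x (fun l => ((2 * N + 1).choose (N + l) : A)) (N + 2)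
    simp only [← choose_two_mul_succ_cast] at h
    rw [← centralSum_eq_sum, Nat.choose_eq_zero_of_lt (show 2 * N + 1 < N + (N + 2) by lia)] at h
    simp only [← mul_assoc, choose_two_mul_succ_mul]
    simp only [mul_assoc]
    rw [← mul_sum, h]
    have := choose_two_mul_succ_cast (A := A) N 0
    simp only [add_zero, zero_add, choose_middle_eq] at this ⊢
    rw [this]; push_cast; ring

lemma two_mul_centralSum (x : A) (N : ℕ) : 2 * centralSum (x + 2) (N + 1) =
      (x + 2) * ∑ l ∈ range (N + 1), ((2 * N + 1).choose (N + 1 + l) : A) * lucasIm x l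
        + ∑ l ∈ range (N + 1), ((2 * N + 1).choose (N + 1 + l) : A) * lucasTrace x l := by
  have h := two_mul_sum_add_mul_lucasIm x (fun l => ((2 * N + 1).choose (N + l) : A)) (N + 2)
  simp only [← choose_two_mul_succ_cast] at h
  rw [← centralSum_eq_sum, Nat.choose_eq_zero_of_lt (show 2 * N + 1 < N + (N + 2) by lia),
    sum_range_succ, sum_range_succ _ (N + 1),
    Nat.choose_eq_zero_of_lt (show 2 * N + 1 < N + (N + 1 + 1) by lia)] at h
  rw [h]
  simp [add_assoc, add_comm 1]

end LucasSequences

/-! ### Divisibility of binomial remainders by `n p²` -/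

section PadicBinomial

variable {p : ℕ} [Fact p.Prime]

lemma PadicInt.isUnit_natCast_of_not_dvd {j : ℕ} (h : ¬ p ∣ j) : IsUnit (j : ℤ_[p]) := by
  rw [PadicInt.isUnit_iff, PadicInt.norm_natCast_eq_one_iff]
  exact (Nat.Prime.coprime_iff_not_dvd Fact.out).2 h

/-- Amounts to `v_p(i) ≤ i - 2`. Oddness is essential: `p = i = 2` is a counterexample. -/
lemma PadicInt.natCast_dvd_prime_pow (hp : Odd p) {i : ℕ} (hi : 2 ≤ i) :
    (i : ℤ_[p]) ∣ (p : ℤ_[p]) ^ (i - 2) := by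
  have hprime : p.Prime := Fact.out
  obtain ⟨v, j, hj, rfl⟩ := Nat.exists_eq_pow_mul_and_not_dvd (by lia : i ≠ 0) p hprime.ne_one
  have hp3 : 3 ≤ p := by
    have := hprime.two_le
    obtain ⟨t, rfl⟩ := hp
    lia
  have hj0 : 1 ≤ j := Nat.one_le_iff_ne_zero.2 (by rintro rfl; simp at hj)
  have hv : v ≤ p ^ v * j - 2 := by
    rcases Nat.eq_zero_or_pos v with rfl | hv
    · simp
    · have h1 : v + 2 ≤ 3 ^ v := by
        clear hi
        induction v, hv using Nat.le_induction with
        | base => norm_num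
        | succ v _ ih => rw [pow_succ]; lia
      have h2 : 3 ^ v ≤ p ^ v := Nat.pow_le_pow_left hp3 v
      have h3 : p ^ v ≤ p ^ v * j := Nat.le_mul_of_pos_right _ hj0
      lia
  push_cast
  rw [(PadicInt.isUnit_natCast_of_not_dvd hj).mul_right_dvd]
  exact pow_dvd_pow _ hv

/-- Absorption, `i C(n, i) = n C(n-1, i-1)`, supplies the factor `n` once `i` is extracted from
`p^(i-2)`. -/
lemma PadicInt.mul_sq_dvd_choose_mul_pow (hp : Odd p) (n : ℕ) {i : ℕ} (hi : 2 ≤ i) :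
    (n : ℤ_[p]) * (p : ℤ_[p]) ^ 2 ∣ (n.choose i : ℤ_[p]) * (p : ℤ_[p]) ^ i := by
  rcases n with _ | n
  · simp [Nat.choose_eq_zero_of_lt (show 0 < i by lia)]
  obtain ⟨c, hc⟩ := PadicInt.natCast_dvd_prime_pow hp hi
  obtain ⟨i, rfl⟩ : ∃ k, i = k + 1 := ⟨i - 1, by lia⟩
  have h := congrArg (Nat.cast (R := ℤ_[p])) (Nat.add_one_mul_choose_eq n i)
  refine ⟨n.choose i * c, ?_⟩
  rw [show (p : ℤ_[p]) ^ (i + 1) = p ^ (i + 1 - 2) * p ^ 2 by rw [← pow_add]; congr 1; lia, hc]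
  push_cast at h ⊢
  linear_combination -c * p ^ 2 * h

lemma exists_add_prime_mul_pow_eq (hp : Odd p) {B : Type*} [CommRing B] [Algebra ℤ_[p] B]
    (a b : B) (n : ℕ) : ∃ t, (a + p * b) ^ n = a ^ n + n * p * a ^ (n - 1) * b + n * p ^ 2 * t := by
  rcases n with _ | n
  · exact ⟨0, by simp⟩
  have hd : ((n + 1 : ℕ) * p ^ 2 : B) ∣
      ∑ i ∈ range n, a ^ (n + 1 - (i + 1 + 1)) * (p * b) ^ (i + 1 + 1) * (n + 1).choose (i + 1 + 1) := by
    refine dvd_sum fun i _ => ?_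
    have h := (map_dvd (algebraMap ℤ_[p] B)
      (PadicInt.mul_sq_dvd_choose_mul_pow hp (n + 1) (show 2 ≤ i + 1 + 1 by lia)))
    simp only [map_mul, map_pow, map_natCast] at h
    refine (h.mul_left (a ^ (n + 1 - (i + 1 + 1)) * b ^ (i + 1 + 1))).trans (dvd_of_eq ?_)
    ring
  obtain ⟨t, ht⟩ := hd
  refine ⟨t, ?_⟩
  rw [add_comm a, add_pow]
  simp only [mul_comm _ (a ^ _)]
  rw [sum_range_succ', sum_range_succ', ht]
  simp
  ring

end PadicBinomial

/-! ### First-order expansion of `(1 + X)^(pN)` under linear functionals -/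

section BinomialTransform

open Polynomial in
lemma lsum_X_pow_mul_pow {A : Type*} [CommRing A] (f : ℕ → A) (j s N : ℕ) :
    lsum (fun i => LinearMap.toSpanSingleton A A (f i)) (X ^ j * (1 + X ^ s) ^ N) =
      ∑ k ∈ range (N + 1), (N.choose k : A) * f (j + s * k) := by
  rw [add_comm (1 : A[X]), add_pow, mul_sum, map_sum]
  refine sum_congr rfl fun k _ => ?_
  rw [one_pow, mul_one, ← pow_mul, ← mul_assoc, ← pow_add, mul_comm, ← C_eq_natCast,
    C_mul_X_pow_eq_monomial]
  change Polynomial.sum _ _ = _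
  rw [sum_monomial_index] <;> simp

variable {p : ℕ} [Fact p.Prime]

open Polynomial in
lemma exists_one_add_X_pow_prime_mul (hp : Odd p) (N : ℕ) : ∃ t : ℤ_[p][X],
    (1 + X) ^ (p * N) = (1 + X ^ p) ^ N
      + (N : ℤ_[p][X]) * ((1 + X ^ p) ^ (N - 1) * ((1 + X) ^ p - 1 - X ^ p))
      + ((N * p ^ 2 : ℕ) : ℤ_[p][X]) * t := by
  have hprime : p.Prime := Fact.out
  obtain ⟨r, hr⟩ := exists_add_pow_prime_eq hprime (1 : ℤ_[p][X]) X
  obtain ⟨t, ht⟩ := exists_add_prime_mul_pow_eq hp (1 + X ^ p : ℤ_[p][X]) (1 * X * r) N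
  have h1 : (1 + X : ℤ_[p][X]) ^ p = 1 + X ^ p + (p : ℤ_[p][X]) * (1 * X * r) := by
    rw [hr, one_pow]; simp only [mul_assoc]
  refine ⟨t, ?_⟩
  rw [pow_mul, h1, ht, add_sub_right_comm, add_sub_cancel_left, add_sub_cancel_left]
  push_cast
  simp only [mul_assoc, mul_left_comm]

open Polynomial in
/-- Expanding `(1 + X) ^ (p * N)` to first order around `(1 + X ^ p) ^ N`. -/
lemma exists_sum_choose_prime_mul (hp : Odd p) (N : ℕ) (f : ℕ → ℤ_[p]) :
    ∃ t, ∑ i ∈ range (p * N + 1), ((p * N).choose i : ℤ_[p]) * f i =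
      ∑ i ∈ range (N + 1), (N.choose i : ℤ_[p]) * f (p * i)
        + N * ∑ i ∈ range (N - 1 + 1), ((N - 1).choose i : ℤ_[p]) *
          (∑ k ∈ range (p + 1), (p.choose k : ℤ_[p]) * f (p * i + k) - f (p * i) - f (p * i + p))
        + N * p ^ 2 * t := by
  have hprime : p.Prime := Fact.out
  obtain ⟨t, ht⟩ := exists_one_add_X_pow_prime_mul hp N
  -- `L` is the linear functional sending `X^i` to `f i`; applied to the polynomial identity it
  -- gives the claim.
  obtain ⟨L, hL⟩ : ∃ L : ℤ_[p][X] →ₗ[ℤ_[p]] ℤ_[p], ∀ j s N, L (X ^ j * (1 + X ^ s) ^ N) =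
      ∑ k ∈ range (N + 1), (N.choose k : ℤ_[p]) * f (j + s * k) := ⟨_, lsum_X_pow_mul_pow f⟩
  have hnat : ∀ (k : ℕ) (q : ℤ_[p][X]), L (k * q) = k * L q := fun k q => by
    rw [← nsmul_eq_mul, map_nsmul, nsmul_eq_mul]
  refine ⟨L t, ?_⟩
  have h := congrArg L ht
  rw [map_add, map_add, hnat, hnat] at h
  have h1 := hL 0 1 (p * N)
  have h2 := hL 0 p N
  simp only [pow_zero, one_mul, pow_one, zero_add] at h1 h2
  rw [h1, h2] at h
  push_cast at h
  rw [h, add_comm (1 : ℤ_[p][X]) (X ^ p), add_pow, sum_mul, map_sum]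
  congr 3
  refine sum_congr rfl fun i _ => ?_
  have h3 := hL (p * i) 1 p
  have h4 := hL (p * i) 1 0
  have h5 := hL (p * i + p) 1 0
  simp only [zero_add, pow_zero, mul_one, pow_one, one_mul, range_one, sum_singleton,
    Nat.choose_self, Nat.cast_one, add_zero] at h3 h4 h5
  rw [← h3, ← h4, ← h5, one_pow, mul_one, ← map_sub, ← map_sub, ← hnat, ← pow_mul, pow_add X (p * i) p]
  refine congrArg L ?_
  rw [mul_comm (X ^ (p * i)) (((N - 1).choose i : ℕ) : ℤ_[p][X])]
  simp only [mul_sub, mul_one, mul_assoc]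

lemma sum_choose_mul_truncated {A : Type*} [CommRing A] (N M : ℕ) (c f : ℕ → A)
    (hf : f 0 = 0) :
    ∑ i ∈ range (N + M), c i * f (i - N) = ∑ l ∈ range M, c (N + l) * f l := by
  rw [sum_range_add, sum_eq_zero, zero_add]
  · simp
  · intro i hi
    rw [Nat.sub_eq_zero_of_le (mem_range.1 hi).le, hf, mul_zero]

/-- The expansion is applied to `f i = u_{i - p(n+1)}` with truncated subtraction, so that `u_0 = 0`
removes the lower half of the binomial row. -/
lemma exists_centralSum_prime_mul (hp : Odd p) (x : ℤ_[p]) (n : ℕ) :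
    ∃ t, centralSum (x + 2) (p * (n + 1)) =
      ∑ l ∈ range (n + 1 + 1), ((2 * (n + 1)).choose (n + 1 + l) : ℤ_[p]) * lucasIm x (p * l)
        + 2 * (n + 1 : ℕ) * ∑ l ∈ range (n + 1), ((2 * n + 1).choose (n + 1 + l) : ℤ_[p]) *
          (((1 + lucasRoot x) ^ p - 1 - lucasRoot x ^ p) * lucasRoot x ^ (p * l)).im
        + (n + 1 : ℕ) * p ^ 2 * t := by
  obtain ⟨t, ht⟩ := exists_sum_choose_prime_mul hp (2 * (n + 1))
    (fun i => lucasIm x (i - p * (n + 1)))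
  refine ⟨2 * t, ?_⟩
  rw [centralSum_eq_sum, ← sum_choose_mul_truncated (p * (n + 1)) _
      (fun i => ((2 * (p * (n + 1))).choose i : ℤ_[p])) _ (lucasIm_zero x),
    show p * (n + 1) + (p * (n + 1) + 1) = p * (2 * (n + 1)) + 1 by ring,
    show 2 * (p * (n + 1)) = p * (2 * (n + 1)) by ring, ht]
  simp only [← Nat.mul_sub]
  rw [show 2 * (n + 1) + 1 = n + 1 + (n + 1 + 1) by ring,
    sum_choose_mul_truncated (n + 1) (n + 1 + 1) (fun i => ((2 * (n + 1)).choose i : ℤ_[p]))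
      (fun i => lucasIm x (p * i)) (by simp),
    show 2 * (n + 1) - 1 = 2 * n + 1 by lia, show 2 * n + 1 + 1 = n + 1 + (n + 1) by ring,
    sum_range_add _ (n + 1) (n + 1), sum_eq_zero (s := range (n + 1)), zero_add]
  · have e : ∀ l, ∑ k ∈ range (p + 1), (p.choose k : ℤ_[p]) *
          lucasIm x (p * (n + 1 + l) + k - p * (n + 1))
        - lucasIm x (p * (n + 1 + l - (n + 1))) - lucasIm x (p * (n + 1 + l) + p - p * (n + 1))
        = (((1 + lucasRoot x) ^ p - 1 - lucasRoot x ^ p) * lucasRoot x ^ (p * l)).im := by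
      intro l
      rw [add_comm (1 : QuadraticAlgebra ℤ_[p] (-1) x), add_pow, sub_mul, sub_mul, sum_mul, im_sub,
        im_sub, ← pow_add, show p * (n + 1 + l) + p - p * (n + 1) = p + p * l by
          rw [mul_add, add_assoc, Nat.add_sub_cancel_left, add_comm],
        show n + 1 + l - (n + 1) = l by lia, one_mul]
      congr 2
      change _ = QuadraticAlgebra.imₗ (-1) x _
      rw [map_sum]
      refine sum_congr rfl fun k _ => ?_
      rw [show p * (n + 1 + l) + k - p * (n + 1) = k + p * l by
        rw [mul_add, add_assoc, Nat.add_sub_cancel_left, add_comm], one_pow, mul_one,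
        mul_right_comm, ← pow_add, mul_comm (_ ^ _)]
      simp [lucasIm]
    simp only [e]
    push_cast; ring
  -- The cut at `p(n+1)` is a multiple of `p`, so no block `[pi, pi + p]` straddles it: each lower
  -- block vanishes entirely.
  · intro i hi
    have hi' : i ≤ n := by simpa [Nat.lt_succ_iff] using hi
    have h1 : p * i + p ≤ p * (n + 1) := by rw [← mul_add_one]; gcongr
    rw [show i - (n + 1) = 0 by lia, Nat.sub_eq_zero_of_le h1, sum_eq_zero]
    · simp
    · intro k hk
      rw [Nat.sub_eq_zero_of_le (by have := mem_range.1 hk; lia)]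
      simp

/-- The functional here extracts the coefficient of `X^(p(n+1))`. The first-order term involves only
exponents `pi + k` with `0 < k < p`, none divisible by `p`, so it vanishes. -/
lemma exists_choose_prime_mul (hp : Odd p) (n : ℕ) :
    ∃ t, ((2 * (p * (n + 1))).choose (p * (n + 1)) : ℤ_[p]) =
      ((2 * (n + 1)).choose (n + 1) : ℤ_[p]) + (n + 1 : ℕ) * p ^ 2 * t := by
  have hprime : p.Prime := Fact.out
  obtain ⟨t, ht⟩ := exists_sum_choose_prime_mul hp (2 * (n + 1))
    (fun i => if i = p * (n + 1) then 1 else 0)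
  refine ⟨2 * t, ?_⟩
  simp only [mul_ite, mul_one, mul_zero, sum_ite_eq', mem_range,
    Nat.mul_right_inj hprime.ne_zero] at ht
  rw [if_pos (by nlinarith [hprime.pos]), if_pos (by lia), sum_eq_zero] at ht
  · rw [show 2 * (p * (n + 1)) = p * (2 * (n + 1)) by ring, ht]
    push_cast; ring
  · intro i _
    rw [sum_range_succ, sum_eq_single_of_mem 0 (mem_range.2 hprime.pos)]
    · simp [hprime.ne_zero]
    · intro k hk hk0
      rw [if_neg]
      intro h
      have : p ∣ k := (Nat.dvd_add_right (dvd_mul_right p i)).1 (h ▸ dvd_mul_right p (n + 1))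
      exact (Nat.le_of_dvd (Nat.pos_of_ne_zero hk0) this).not_gt (mem_range.1 hk)

end BinomialTransform

/-! ### Congruences for Lucas sequences and the deviation term -/

section LucasCongruences

variable {p : ℕ} [Fact p.Prime]

lemma PadicInt.prime_dvd_iff_toZMod (a : ℤ_[p]) : (p : ℤ_[p]) ∣ a ↔ PadicInt.toZMod a = 0 := by
  rw [← RingHom.mem_ker, PadicInt.ker_toZMod, PadicInt.maximalIdeal_eq_span_p,
    Ideal.mem_span_singleton]

lemma PadicInt.prime_dvd_pow_sub_self (a : ℤ_[p]) : (p : ℤ_[p]) ∣ a ^ p - a := by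
  rw [PadicInt.prime_dvd_iff_toZMod]
  simp

lemma PadicInt.isUnit_two (hp : Odd p) : IsUnit (2 : ℤ_[p]) := by
  have hprime : p.Prime := Fact.out
  refine mod_cast PadicInt.isUnit_natCast_of_not_dvd (p := p) (j := 2) fun h => ?_
  have := (Nat.prime_dvd_prime_iff_eq hprime Nat.prime_two).1 h
  subst this
  exact absurd hp (by decide)

lemma PadicInt.isUnit_add_prime_mul {a : ℤ_[p]} (ha : IsUnit a) (b : ℤ_[p]) :
    IsUnit (a + p * b) := by
  by_contra h
  have h1 : (p : ℤ_[p]) ∣ a + p * b := by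
    rwa [← Ideal.mem_span_singleton, ← PadicInt.maximalIdeal_eq_span_p, IsLocalRing.mem_maximalIdeal]
  have h2 : (p : ℤ_[p]) ∣ a := (dvd_add_left (dvd_mul_right _ _)).1 h1
  rw [← Ideal.mem_span_singleton, ← PadicInt.maximalIdeal_eq_span_p,
    IsLocalRing.mem_maximalIdeal] at h2
  exact h2 ha

variable {x : ℤ_[p]}

/-- Frobenius modulo `p` applied to `α + star α = x`. -/
lemma prime_dvd_lucasTrace_sub : (p : ℤ_[p]) ∣ lucasTrace x p - x := by
  have hprime : p.Prime := Fact.out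
  obtain ⟨r, hr⟩ := exists_add_pow_prime_eq hprime (lucasRoot x) (star (lucasRoot x))
  rw [← algebraMap_trace_eq_add_star, ← map_pow, ← star_pow, ← algebraMap_trace_eq_add_star] at hr
  have h := congrArg re hr
  rw [mul_assoc, mul_assoc, ← C_natCast, C_mul_eq_smul, re_add, algebraMap_re, algebraMap_re,
    re_smul] at h
  obtain ⟨c, hc⟩ := PadicInt.prime_dvd_pow_sub_self x
  have hx : trace (lucasRoot x) = x := by simp [lucasRoot]
  rw [hx] at h
  change x ^ p = lucasTrace x p + _ • _ at h
  rw [smul_eq_mul] at h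
  exact ⟨c - (lucasRoot x * (star (lucasRoot x) * r)).re, by linear_combination hc - h⟩

/-- Frobenius modulo `p` applied to `α - star α`, whose square is `x² - 4`. -/
lemma prime_dvd_lucasIm_sub (hp : Odd p) {e : ℤ_[p]}
    (he : (p : ℤ_[p]) ∣ (x ^ 2 - 4) ^ (p / 2) - e) : (p : ℤ_[p]) ∣ lucasIm x p - e := by
  have hprime : p.Prime := Fact.out
  obtain ⟨r, hr⟩ := exists_add_pow_prime_eq hprime (lucasRoot x) (-star (lucasRoot x))
  rw [hp.neg_pow, ← star_pow, ← sub_eq_add_neg, ← sub_eq_add_neg] at hr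
  have h1 : (lucasRoot x - star (lucasRoot x)) ^ p =
      QuadraticAlgebra.C ((x ^ 2 - 4) ^ (p / 2)) * (lucasRoot x - star (lucasRoot x)) := by
    have : (lucasRoot x - star (lucasRoot x)) ^ 2 = QuadraticAlgebra.C (x ^ 2 - 4) := by
      ext <;> simp [sq, lucasRoot, re_mul, im_mul] <;> ring
    have h2 : p = 2 * (p / 2) + 1 := by have := Nat.odd_iff.1 hp; lia
    rw [congrArg (fun i => (lucasRoot x - star (lucasRoot x)) ^ i) h2, pow_add, pow_mul, this, ← C_pow, pow_one]
  rw [h1] at hr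
  have h := congrArg im hr
  rw [mul_assoc, mul_assoc, ← C_natCast, C_mul_eq_smul, C_mul_eq_smul, im_add, im_smul,
    im_smul, im_sub, im_sub, im_star, im_star] at h
  have h2 : (lucasRoot x).im = 1 := rfl
  rw [h2, smul_eq_mul, smul_eq_mul] at h
  change _ = lucasIm x p - - lucasIm x p + _ at h
  obtain ⟨c, hc⟩ := he
  rw [← (PadicInt.isUnit_two hp).dvd_mul_left]
  exact ⟨2 * c - (lucasRoot x * (-star (lucasRoot x) * r)).im, by linear_combination 2 * hc - h⟩

lemma exists_eq_one_add_prime_mul (hp : Odd p) {z : QuadraticAlgebra ℤ_[p] (-1) x}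
    (h1 : (p : ℤ_[p]) ∣ z.im) (h2 : (p : ℤ_[p]) ∣ trace z - 2) : ∃ y, z = 1 + p * y := by
  obtain ⟨a, ha⟩ := h1
  have h3 : (p : ℤ_[p]) ∣ z.re - 1 := by
    rw [← (PadicInt.isUnit_two hp).dvd_mul_left]
    obtain ⟨b, hb⟩ := h2
    rw [trace_def] at hb
    exact ⟨b - x * a, by linear_combination hb - x * ha⟩
  obtain ⟨b, hb⟩ := h3
  refine ⟨⟨b, a⟩, ?_⟩
  rw [← C_natCast, C_mul_eq_smul]
  ext
  · simp only [re_add, re_one, re_smul, smul_eq_mul]; linear_combination hb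
  · simp only [im_add, im_one, im_smul, smul_eq_mul]; linear_combination ha

lemma exists_pow_mul_eq (hp : Odd p) {z : QuadraticAlgebra ℤ_[p] (-1) x}
    (h1 : (p : ℤ_[p]) ∣ z.im) (h2 : (p : ℤ_[p]) ∣ trace z - 2) (l : ℕ)
    (w : QuadraticAlgebra ℤ_[p] (-1) x) :
    (∃ t, 2 * (z ^ l * w).im = 2 * w.im + l * (z.im * trace w + (trace z - 2) * w.im)
      + l * p ^ 2 * t) ∧ (p : ℤ_[p]) ∣ trace (z ^ l * w) - trace w := by
  obtain ⟨y, hy⟩ := exists_eq_one_add_prime_mul hp h1 h2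
  obtain ⟨s, hs⟩ := exists_add_prime_mul_pow_eq hp 1 y l
  have e : z ^ l * w = w + QuadraticAlgebra.C (l : ℤ_[p]) * ((z - 1) * w) + QuadraticAlgebra.C (l * p ^ 2 : ℤ_[p]) * (s * w) := by
    rw [hy, hs, C_mul, C_pow, C_natCast, C_natCast, one_pow, one_pow]; ring
  have e' : z ^ l * w = w + QuadraticAlgebra.C (p : ℤ_[p]) * ((QuadraticAlgebra.C (l : ℤ_[p]) * y + QuadraticAlgebra.C (l * p : ℤ_[p]) * s) * w) := by
    rw [hy, hs, C_mul, C_natCast, C_natCast, one_pow, one_pow]; ring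
  constructor
  · refine ⟨2 * (s * w).im, ?_⟩
    have h3 := two_mul_im_mul (z - 1) w
    rw [map_sub, trace_one, im_sub, im_one, sub_zero] at h3
    rw [e, C_mul_eq_smul, C_mul_eq_smul, im_add, im_add, im_smul, im_smul, smul_eq_mul, smul_eq_mul]
    linear_combination l * h3
  · rw [e', C_mul_eq_smul, map_add, add_sub_cancel_left, map_smul]
    exact dvd_mul_right _ _

/-- `e` plays the role of the Legendre symbol of `x ^ 2 - 4`, and `k` of `p - e`. -/
def IsLucasRank (x e : ℤ_[p]) (k : ℕ) : Prop :=
  (e = 1 ∧ k + 1 = p ∧ IsUnit (x - 2)) ∨ (e = -1 ∧ k = p + 1 ∧ IsUnit (x - 2)) ∨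
    (e = 0 ∧ k = p ∧ (p : ℤ_[p]) ∣ x - 2)

lemma prime_dvd_lucasTrace_sub_two {y : ℤ_[p]} (h : (p : ℤ_[p]) ∣ y - 2) (l : ℕ) :
    (p : ℤ_[p]) ∣ lucasTrace y l - 2 ∧ (p : ℤ_[p]) ∣ lucasTrace y (l + 1) - 2 := by
  induction l with
  | zero => simpa using h
  | succ l ih =>
    refine ⟨ih.2, ?_⟩
    obtain ⟨a, ha⟩ := ih.1
    obtain ⟨b, hb⟩ := ih.2
    obtain ⟨c, hc⟩ := h
    rw [lucasTrace_add_two]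
    exact ⟨b * y + 2 * c - a, by linear_combination y * hb + 2 * hc - ha⟩

lemma IsLucasRank.two_mul_eq {e : ℤ_[p]} {k : ℕ} (h : IsLucasRank x e k) (he : e ≠ 0) :
    e ^ 2 = 1 ∧ IsUnit (x - 2) ∧ 2 * lucasIm x p = x * lucasIm x k + e * lucasTrace x k ∧
      2 * lucasTrace x p = x * lucasTrace x k + e * (x ^ 2 - 4) * lucasIm x k := by
  obtain ⟨rfl, hk, hu⟩ | ⟨rfl, hk, hu⟩ | ⟨rfl, _⟩ := h
  · have h3 := two_mul_lucasIm_succ x k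
    have h4 := two_mul_lucasTrace_succ x k
    rw [hk] at h3 h4
    exact ⟨by ring, hu, by linear_combination h3, by linear_combination h4⟩
  · have h3 := two_mul_lucasIm_eq_succ x p
    have h4 := two_mul_lucasTrace_eq_succ x p
    rw [← hk] at h3 h4
    exact ⟨by ring, hu, by linear_combination h3, by linear_combination h4⟩
  · exact absurd rfl he

/-- For `e = ±1` the relations of `two_mul_eq` express `u_p`, `v_p` through `u_k`, `v_k` by a system
of determinant 4 up to sign; it is inverted using `u_p ≡ e` and `v_p ≡ x`. -/
lemma IsLucasRank.prime_dvd (hp : Odd p) {e : ℤ_[p]} {k : ℕ} (h : IsLucasRank x e k)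
    (hu : (p : ℤ_[p]) ∣ lucasIm x p - e) :
    (p : ℤ_[p]) ∣ lucasIm x k ∧ (p : ℤ_[p]) ∣ lucasTrace x k - 2 := by
  obtain ⟨b, hb⟩ := prime_dvd_lucasTrace_sub (x := x)
  obtain ⟨a, ha⟩ := hu
  by_cases he : e = 0
  · obtain ⟨rfl, hk, c, hc⟩ : e = 0 ∧ k = p ∧ (p : ℤ_[p]) ∣ x - 2 := by
      simpa [IsLucasRank, he] using h
    rw [hk]
    exact ⟨⟨a, by linear_combination ha⟩, b + c, by linear_combination hb + hc⟩
  · obtain ⟨h1, -, h3, h4⟩ := h.two_mul_eq he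
    have h2 := (PadicInt.isUnit_two hp).mul (PadicInt.isUnit_two hp)
    refine ⟨h2.dvd_mul_left.1 ?_, h2.dvd_mul_left.1 ?_⟩
    · exact ⟨2 * x * a - 2 * e * b, by
        linear_combination 2 * x * ha - 2 * e * hb - x * h3 + e * h4 + (x ^ 2 - 4) * lucasIm x k * h1⟩
    · exact ⟨2 * x * b - 2 * e * (x ^ 2 - 4) * a, by
        linear_combination 2 * x * hb - 2 * e * (x ^ 2 - 4) * ha - x * h4 + e * (x ^ 2 - 4) * h3
          + ((x ^ 2 - 4) * lucasTrace x k - 2 * (x ^ 2 - 4)) * h1⟩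

/-- In `(v_k - 2)(v_k + 2) = (x² - 4) u_k²` the right side is divisible by `p²`, while `v_k + 2 ≡ 4`
is a unit. -/
lemma IsLucasRank.prime_sq_dvd (hp : Odd p) {e : ℤ_[p]} {k : ℕ} (h : IsLucasRank x e k)
    (hu : (p : ℤ_[p]) ∣ lucasIm x p - e) : (p : ℤ_[p]) ^ 2 ∣ lucasTrace x k - 2 := by
  obtain ⟨⟨a, ha⟩, b, hb⟩ := h.prime_dvd hp hu
  have h2 := PadicInt.isUnit_add_prime_mul ((PadicInt.isUnit_two hp).mul (PadicInt.isUnit_two hp)) b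
  rw [← h2.dvd_mul_left]
  exact ⟨(x ^ 2 - 4) * a ^ 2, by
    linear_combination trace_sq_sub_lucas x k + (x ^ 2 - 4) * (lucasIm x k + p * a) * ha
      - (lucasTrace x k - 2) * hb⟩

/-- The cofactor `w l` is `α^l`, its conjugate, or 1, according to `e = 1, -1, 0`. In the last case
`x ≡ 2` gives `v_l ≡ 2`, the trace of 1. -/
lemma IsLucasRank.exists_factorization {e : ℤ_[p]} {k : ℕ}
    (h : IsLucasRank x e k) :
    ∃ w : ℕ → QuadraticAlgebra ℤ_[p] (-1) x, ∀ l,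
      lucasRoot x ^ (p * l) = (lucasRoot x ^ k) ^ l * w l ∧ (w l).im = e * lucasIm x l ∧
        (p : ℤ_[p]) ∣ trace (w l) - lucasTrace x l := by
  obtain ⟨rfl, hk, -⟩ | ⟨rfl, hk, -⟩ | ⟨rfl, hk, hx⟩ := h
  · refine ⟨fun l => lucasRoot x ^ l, fun l => ⟨?_, ?_, ?_⟩⟩
    · rw [← pow_mul, ← pow_add, ← add_one_mul, hk]
    · simp [lucasIm]
    · simp [lucasTrace]
  · refine ⟨fun l => star (lucasRoot x ^ l), fun l => ⟨?_, ?_, ?_⟩⟩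
    · beta_reduce
      rw [← pow_mul, hk, add_mul, one_mul, pow_add, star_pow, mul_assoc, ← mul_pow,
        lucasRoot_mul_star, one_pow, mul_one]
    · simp [lucasIm, -star_pow]
    · simp [lucasTrace, -star_pow]
  · refine ⟨fun l => 1, fun l => ⟨?_, ?_, ?_⟩⟩
    · rw [← pow_mul, hk, mul_one]
    · simp [im_one]
    · rw [trace_one, ← neg_sub, dvd_neg]
      exact (prime_dvd_lucasTrace_sub_two hx l).1

lemma IsLucasRank.exists_lucasIm_prime_mul (hp : Odd p) {e : ℤ_[p]} {k : ℕ}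
    (h : IsLucasRank x e k) (hu : (p : ℤ_[p]) ∣ lucasIm x p - e) (l : ℕ) :
    (∃ t, 2 * lucasIm x (p * l) = 2 * e * lucasIm x l + l * (lucasIm x k * lucasTrace x l)
      + l * p ^ 2 * t) ∧ (p : ℤ_[p]) ∣ lucasTrace x (p * l) - lucasTrace x l := by
  obtain ⟨h1, h2⟩ := h.prime_dvd hp hu
  obtain ⟨c, hc⟩ := h.prime_sq_dvd hp hu
  obtain ⟨w, hw⟩ := h.exists_factorization
  obtain ⟨hw1, hw2, b, hb⟩ := hw l
  obtain ⟨⟨t, ht⟩, s, hs⟩ := exists_pow_mul_eq hp h1 h2 l (w l)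
  obtain ⟨a, ha⟩ := h1
  rw [← hw1] at ht hs
  change 2 * lucasIm x (p * l) = 2 * (w l).im + l * (lucasIm x k * trace (w l) +
    (lucasTrace x k - 2) * (w l).im) + _ at ht
  constructor
  · refine ⟨t + a * b + c * e * lucasIm x l, ?_⟩
    linear_combination ht + (2 + l * (lucasTrace x k - 2)) * hw2 + l * lucasIm x k * hb
      + l * p * b * ha + l * e * lucasIm x l * hc
  · exact ⟨s + b, by change trace _ - _ = _; linear_combination hs + hb⟩

/-- `(1 + α) ^ p` determines the first-order deviation of the binomial transform from Frobenius. -/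
lemma one_add_lucasRoot_pow :
    (trace ((1 + lucasRoot x) ^ p) * ((1 + lucasRoot x) ^ p).im = (x + 2) ^ p * lucasIm x p ∧
    trace ((1 + lucasRoot x) ^ p) ^ 2 = (x + 2) ^ p * (lucasTrace x p + 2) ∧
    (x ^ 2 - 4) * ((1 + lucasRoot x) ^ p).im ^ 2 = (x + 2) ^ p * (lucasTrace x p - 2)) ∧
    (p : ℤ_[p]) ∣ ((1 + lucasRoot x) ^ p).im - lucasIm x p ∧
    (p : ℤ_[p]) ∣ trace ((1 + lucasRoot x) ^ p) - (lucasTrace x p + 2) := by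
  have hprime : p.Prime := Fact.out
  have hsq : (1 + lucasRoot x) ^ 2 = QuadraticAlgebra.C (x + 2) * lucasRoot x := by
    ext <;> simp [sq, lucasRoot, re_mul, im_mul, re_one, im_one]; ring
  have hnorm : norm ((1 + lucasRoot x) ^ p) = (x + 2) ^ p := by
    rw [map_pow]
    congr 1
    simp only [norm_def, lucasRoot, re_add, im_add, re_one, im_one, omega_re, omega_im]
    ring
  obtain ⟨r, hr⟩ := exists_add_pow_prime_eq hprime 1 (lucasRoot x)
  rw [one_pow, mul_one, mul_assoc, ← C_natCast, C_mul_eq_smul] at hr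
  have hz : ((1 + lucasRoot x) ^ p) * ((1 + lucasRoot x) ^ p) =
      (x + 2) ^ p • lucasRoot x ^ p := by
    rw [← sq, ← pow_mul, mul_comm p 2, pow_mul, hsq, mul_pow, ← C_pow, C_mul_eq_smul]
  have h1 := two_mul_im_mul ((1 + lucasRoot x) ^ p) ((1 + lucasRoot x) ^ p)
  have h2 := two_mul_trace_mul ((1 + lucasRoot x) ^ p) ((1 + lucasRoot x) ^ p)
  have h3 := trace_sq_sub ((1 + lucasRoot x) ^ p)
  rw [hnorm] at h3
  rw [hz, im_smul, smul_eq_mul] at h1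
  rw [hz, map_smul, smul_eq_mul] at h2
  change 2 * (_ * lucasIm x p) = _ at h1
  change 2 * (_ * lucasTrace x p) = _ at h2
  refine ⟨⟨?_, ?_, ?_⟩, ?_, ?_⟩
  · refine mul_left_cancel₀ (two_ne_zero (α := ℤ_[p])) ?_
    linear_combination -h1
  · refine mul_left_cancel₀ (two_ne_zero (α := ℤ_[p])) ?_
    linear_combination -h2 + h3
  · refine mul_left_cancel₀ (two_ne_zero (α := ℤ_[p])) ?_
    linear_combination -h2 - h3
  · rw [hr]
    simp [lucasIm, im_one]
  · rw [hr]
    simp [lucasTrace, add_comm]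

/-- The trace `T` and imaginary part `s` of `(1 + α)^p` are known modulo `p`, and their squares and
product exactly. This determines them modulo `p²`, as a square root near a known unit is found by
linearization. -/
lemma IsLucasRank.deviation (hp : Odd p) {e : ℤ_[p]} {k : ℕ} (h : IsLucasRank x e k)
    (hM : IsUnit (x + 2)) (hu : (p : ℤ_[p]) ∣ lucasIm x p - e) :
    (p : ℤ_[p]) ∣ ((1 + lucasRoot x) ^ p - 1 - lucasRoot x ^ p).im ∧
    (p : ℤ_[p]) ∣ trace ((1 + lucasRoot x) ^ p - 1 - lucasRoot x ^ p) ∧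
    (p : ℤ_[p]) ^ 2 ∣ 4 * ((1 + lucasRoot x) ^ p - 1 - lucasRoot x ^ p).im -
      (2 * e * ((x + 2) ^ (p - 1) - 1) - (x - 2) * lucasIm x k) ∧
    (p : ℤ_[p]) ^ 2 ∣ e * (trace ((1 + lucasRoot x) ^ p - 1 - lucasRoot x ^ p)) -
      (x + 2) * ((1 + lucasRoot x) ^ p - 1 - lucasRoot x ^ p).im := by
  have hprime : p.Prime := Fact.out
  obtain ⟨⟨h1, h2, h3⟩, ⟨i, hi⟩, ⟨j, hj⟩⟩ := one_add_lucasRoot_pow (x := x)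
  obtain ⟨⟨a, ha⟩, -⟩ := h.prime_dvd hp hu
  obtain ⟨c, hc⟩ := h.prime_sq_dvd hp hu
  obtain ⟨u, hu⟩ := hu
  obtain ⟨b, hb⟩ := prime_dvd_lucasTrace_sub (x := x)
  obtain ⟨q, hq⟩ : (p : ℤ_[p]) ∣ (x + 2) ^ (p - 1) - 1 := by
    rw [← hM.dvd_mul_left, mul_sub, mul_pow_sub_one hprime.ne_zero, mul_one]
    exact PadicInt.prime_dvd_pow_sub_self _
  have hpow := mul_pow_sub_one hprime.ne_zero (x + 2)
  rw [im_sub, im_sub, map_sub, map_sub, im_one, trace_one, sub_zero]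
  change _ ∣ _ - lucasIm x p ∧ _ ∣ _ - _ - lucasTrace x p ∧
    _ ∣ 4 * (_ - lucasIm x p) - _ ∧ _ ∣ e * (_ - _ - lucasTrace x p) - _ * (_ - lucasIm x p)
  rw [← hpow] at h1 h2 h3
  set s := ((1 + lucasRoot x) ^ p).im
  set T := trace ((1 + lucasRoot x) ^ p)
  set Q := (x + 2) ^ (p - 1)
  refine ⟨⟨i, hi⟩, ⟨j, by linear_combination hj⟩, ?_⟩
  have h2u := PadicInt.isUnit_two hp
  by_cases he : e = 0
  · obtain ⟨rfl, hk, d, hd⟩ : e = 0 ∧ k = p ∧ (p : ℤ_[p]) ∣ x - 2 := by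
      simpa [IsLucasRank, he] using h
    -- When `e = 0`, both `s` and `u_p` are divisible by `p`, so in `sT = m^p u_p` the factors `T`
    -- and `m^p` matter only modulo `p`, where both are `x + 2`.
    have hsu : (p : ℤ_[p]) ^ 2 ∣ s - lucasIm x p := by
      rw [← hM.dvd_mul_left]
      exact ⟨(x + 2) * q * u - (b + j) * (u + i), by
        linear_combination h1 + (x + 2) * lucasIm x p * hq + (x + 2) * p * q * hu
          - s * (hj + hb) - p * (b + j) * (hi + hu)⟩
    obtain ⟨t, ht⟩ := hsu
    refine ⟨⟨4 * t + d * a, ?_⟩, ⟨- (x + 2) * t, ?_⟩⟩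
    · linear_combination 4 * ht + lucasIm x k * hd + p * d * ha
    · linear_combination - (x + 2) * ht
  · obtain ⟨h4, h5, h6, h7⟩ := h.two_mul_eq he
    have hs : (p : ℤ_[p]) ^ 2 ∣ 4 * (s - lucasIm x p) - (2 * e * (Q - 1) - (x - 2) * lucasIm x k) := by
      have : (p : ℤ_[p]) ^ 2 ∣ 2 * s ^ 2 - Q * (2 + e * (x + 2) * lucasIm x k) := by
        rw [← h5.dvd_mul_left, ← hM.dvd_mul_left]
        exact ⟨(x + 2) * Q * x * c, by
          linear_combination 2 * h3 + (x + 2) * Q * h7 + (x + 2) * Q * x * hc⟩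
      obtain ⟨t, ht⟩ := this
      -- Since `s ≡ e` modulo `p`, the square `(s - e)²` vanishes modulo `p²`, so `s²` may be
      -- replaced by `2es - 1`.
      have hse : s = e + p * (i + u) := by linear_combination hi + hu
      have h8 : 4 * e * s = 2 + 2 * Q + e * (x + 2) * lucasIm x k
          + p ^ 2 * (t + q * e * (x + 2) * a - 2 * (i + u) ^ 2) := by
        linear_combination ht - 2 * (s - e + p * (i + u)) * hse + 2 * h4
          + e * (x + 2) * lucasIm x k * hq + e * (x + 2) * p * q * ha
      refine ⟨e * (t + q * e * (x + 2) * a - 2 * (i + u) ^ 2) - 2 * c * e , ?_⟩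
      linear_combination e * h8 - 4 * s * h4 - 2 * h6 - 2 * e * hc + (x + 2) * lucasIm x k * h4
    refine ⟨hs, ?_⟩
    obtain ⟨t, ht⟩ := hs
    obtain ⟨g, hg⟩ : (p : ℤ_[p]) ^ 2 ∣ 4 * T - Q * (2 * lucasTrace x p + 4) - 2 * (x + 2) := by
      rw [← hM.dvd_mul_left]
      have hT : T = x + 2 + p * (j + b) := by linear_combination hj + hb
      exact ⟨-2 * (j + b) ^ 2, by
        linear_combination 2 * h2 - 2 * (T - (x + 2) + p * (j + b)) * hT⟩
    have h8 : 4 * (T - 2 - lucasTrace x p) = 2 * (x + 2) * (Q - 1) - e * (x ^ 2 - 4) * lucasIm x k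
        + p ^ 2 * (g + q * e * (x ^ 2 - 4) * a + Q * x * c - 2 * x * c) := by
      linear_combination hg + (Q - 2) * h7 + (Q - 2) * x * hc
        + e * (x ^ 2 - 4) * lucasIm x k * hq + e * (x ^ 2 - 4) * p * q * ha
    rw [← (h2u.mul h2u).dvd_mul_left]
    exact ⟨e * (g + q * e * (x ^ 2 - 4) * a + Q * x * c - 2 * x * c) - (x + 2) * t, by
      linear_combination e * h8 - (x + 2) * ht - (x ^ 2 - 4) * lucasIm x k * h4⟩

/-- Both coordinates of the deviation are divisible by `p`, so `α^(pl)` enters only modulo `p`,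
through `v_l` and `e u_l`. The resulting combination `v_l + (x + 2) u_l` is the one that
`two_mul_centralSum` sums. -/
lemma IsLucasRank.prime_sq_dvd_im_mul (hp : Odd p) {e : ℤ_[p]} {k : ℕ} (h : IsLucasRank x e k)
    (hM : IsUnit (x + 2)) (hu : (p : ℤ_[p]) ∣ lucasIm x p - e) (l : ℕ) :
    (p : ℤ_[p]) ^ 2 ∣
      8 * (((1 + lucasRoot x) ^ p - 1 - lucasRoot x ^ p) * lucasRoot x ^ (p * l)).im -
      (2 * e * ((x + 2) ^ (p - 1) - 1) - (x - 2) * lucasIm x k) *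
        (lucasTrace x l + (x + 2) * lucasIm x l) := by
  obtain ⟨⟨a, ha⟩, ⟨b, hb⟩, ⟨c, hc⟩, ⟨d, hd⟩⟩ := h.deviation hp hM hu
  obtain ⟨⟨t, ht⟩, ⟨r, hr⟩⟩ := h.exists_lucasIm_prime_mul hp hu l
  obtain ⟨⟨f, hf⟩, -⟩ := h.prime_dvd hp hu
  have h1 := two_mul_im_mul ((1 + lucasRoot x) ^ p - 1 - lucasRoot x ^ p) (lucasRoot x ^ (p * l))
  change 2 * _ = _ * lucasTrace x (p * l) + _ * lucasIm x (p * l) at h1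
  refine ⟨4 * a * r + 2 * b * (l * f * lucasTrace x l + l * p * t) + 4 * d * lucasIm x l
    + c * (lucasTrace x l + (x + 2) * lucasIm x l), ?_⟩
  set Y := (1 + lucasRoot x) ^ p - 1 - lucasRoot x ^ p
  linear_combination 4 * h1 + 4 * Y.im * hr + 4 * p * r * ha + 2 * trace Y * ht
    + 2 * trace Y * l * lucasTrace x l * hf
    + 2 * p * (l * f * lucasTrace x l + l * p * t) * hb + 4 * lucasIm x l * hd
    + (lucasTrace x l + (x + 2) * lucasIm x l) * hc

lemma IsLucasRank.prime_sq_dvd_sum_im_mul (hp : Odd p) {e : ℤ_[p]} {k : ℕ}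
    (h : IsLucasRank x e k) (hM : IsUnit (x + 2)) (hu : (p : ℤ_[p]) ∣ lucasIm x p - e) (n : ℕ) :
    (p : ℤ_[p]) ^ 2 ∣
      4 * ∑ l ∈ range (n + 1), ((2 * n + 1).choose (n + 1 + l) : ℤ_[p]) *
        (((1 + lucasRoot x) ^ p - 1 - lucasRoot x ^ p) * lucasRoot x ^ (p * l)).im -
      (2 * e * ((x + 2) ^ (p - 1) - 1) - (x - 2) * lucasIm x k) * centralSum (x + 2) (n + 1) := by
  rw [← (PadicInt.isUnit_two hp).dvd_mul_left]
  have h1 : (p : ℤ_[p]) ^ 2 ∣ ∑ l ∈ range (n + 1), ((2 * n + 1).choose (n + 1 + l) : ℤ_[p]) *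
      (8 * (((1 + lucasRoot x) ^ p - 1 - lucasRoot x ^ p) * lucasRoot x ^ (p * l)).im -
        (2 * e * ((x + 2) ^ (p - 1) - 1) - (x - 2) * lucasIm x k) *
        (lucasTrace x l + (x + 2) * lucasIm x l)) :=
    dvd_sum fun l _ => (h.prime_sq_dvd_im_mul hp hM hu l).mul_left _
  refine h1.trans (dvd_of_eq ?_)
  generalize 2 * e * ((x + 2) ^ (p - 1) - 1) - (x - 2) * lucasIm x k = K
  rw [mul_sub, mul_left_comm 2 K, two_mul_centralSum]
  simp only [mul_sum, ← sum_add_distrib, ← sum_sub_distrib]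
  exact sum_congr rfl fun l _ => by ring

lemma IsLucasRank.dvd_sum_lucasIm_prime_mul (hp : Odd p) {e : ℤ_[p]} {k : ℕ}
    (h : IsLucasRank x e k) (hu : (p : ℤ_[p]) ∣ lucasIm x p - e) (n : ℕ) :
    ((n + 1 : ℕ) : ℤ_[p]) * (p : ℤ_[p]) ^ 2 ∣
      2 * ∑ l ∈ range (n + 1 + 1), ((2 * (n + 1)).choose (n + 1 + l) : ℤ_[p]) * lucasIm x (p * l) -
      (2 * e * centralSum (x + 2) (n + 1) + lucasIm x k * ((n + 1 : ℕ) *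
        (((2 * (n + 1)).choose (n + 1) : ℤ_[p]) + (x - 2) * centralSum (x + 2) (n + 1)))) := by
  have h1 : ((n + 1 : ℕ) : ℤ_[p]) * (p : ℤ_[p]) ^ 2 ∣ ∑ l ∈ range (n + 1 + 1),
      ((2 * (n + 1)).choose (n + 1 + l) : ℤ_[p]) * (2 * lucasIm x (p * l) -
        (2 * e * lucasIm x l + l * (lucasIm x k * lucasTrace x l))) := by
    refine dvd_sum fun l _ => ?_
    obtain ⟨⟨t, ht⟩, -⟩ := h.exists_lucasIm_prime_mul hp hu l
    rw [ht, add_sub_cancel_left, mul_assoc (l : ℤ_[p]), ← mul_assoc, choose_two_mul_succ_mul]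
    exact ⟨(((2 * n + 1).choose (n + l) : ℤ_[p]) - ((2 * n + 1).choose (n + (l + 1)) : ℤ_[p])) * t,
      by ring⟩
  refine h1.trans (dvd_of_eq ?_)
  rw [← sum_choose_mul_lucasTrace, centralSum_eq_sum]
  simp only [mul_sum, ← sum_add_distrib, ← sum_sub_distrib]
  exact sum_congr rfl fun l _ => by ring

lemma exists_pow_prime_sub_one_mul (hp : Odd p) {M : ℤ_[p]} (hM : IsUnit M) (n : ℕ) :
    ∃ q t, M ^ (p - 1) = 1 + p * q ∧ M ^ ((p - 1) * n) = 1 + n * p * q + n * p ^ 2 * t := by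
  have hprime : p.Prime := Fact.out
  obtain ⟨q, hq⟩ : (p : ℤ_[p]) ∣ M ^ (p - 1) - 1 := by
    rw [← hM.dvd_mul_left, mul_sub, mul_pow_sub_one hprime.ne_zero, mul_one]
    exact PadicInt.prime_dvd_pow_sub_self _
  obtain ⟨t, ht⟩ := exists_add_prime_mul_pow_eq hp (1 : ℤ_[p]) q n
  have hq' : M ^ (p - 1) = 1 + p * q := by linear_combination hq
  exact ⟨q, t, hq', by rw [pow_mul, hq', ht]; simp⟩

theorem IsLucasRank.dvd_centralSum_prime_mul (hp : Odd p) {e : ℤ_[p]} {k : ℕ}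
    (h : IsLucasRank x e k) (hM : IsUnit (x + 2)) (hu : (p : ℤ_[p]) ∣ lucasIm x p - e) (n : ℕ) :
    ((n + 1 : ℕ) : ℤ_[p]) * (p : ℤ_[p]) ^ 2 ∣ centralSum (x + 2) (p * (n + 1)) -
      (x + 2) ^ ((p - 1) * (n + 1)) * (e * centralSum (x + 2) (n + 1) +
        (n + 1 : ℕ) * (((2 * n + 1).choose n : ℤ_[p]) * lucasIm x k)) := by
  obtain ⟨t, ht⟩ := exists_centralSum_prime_mul hp x n
  obtain ⟨a, ha⟩ := h.dvd_sum_lucasIm_prime_mul hp hu n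
  obtain ⟨b, hb⟩ := h.prime_sq_dvd_sum_im_mul hp hM hu n
  obtain ⟨q, s, hq, hs⟩ := exists_pow_prime_sub_one_mul hp hM (n + 1)
  obtain ⟨⟨f, hf⟩, -⟩ := h.prime_dvd hp hu
  have hc := choose_two_mul_succ_cast (A := ℤ_[p]) n 0
  simp only [add_zero, zero_add, choose_middle_eq] at hc
  rw [← (PadicInt.isUnit_two hp).dvd_mul_left, ht, hs]
  set G := centralSum (x + 2) (n + 1)
  set c := ((2 * n + 1).choose n : ℤ_[p])
  -- The contributions `±n (x - 2) u_k G` of the two sums cancel. The term with `f` absorbs the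
  -- product of `m^(p-1) - 1` and `u_k`, both divisible by `p`.
  refine ⟨2 * t + a + b - 2 * s * (e * G + (n + 1 : ℕ) * (c * lucasIm x k))
    - 2 * (n + 1 : ℕ) * q * c * f, ?_⟩
  linear_combination ha + (n + 1 : ℕ) * hb - 2 * (n + 1 : ℕ) ^ 2 * p * q * c * hf
    + (n + 1 : ℕ) * lucasIm x k * hc + 2 * (n + 1 : ℕ) * e * G * hq

end LucasCongruences

/-! ### Rational sums and telescoping -/

section RationalSums

lemma centralSum_cast {A : Type*} [CommRing A] (m : ℤ) (N : ℕ) :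
    ((centralSum m N : ℤ) : A) = centralSum (m : A) N := by
  induction N with
  | zero => simp [centralSum]
  | succ N ih => simp [centralSum, ih]

lemma sum_centralBinom_div_mul_pow {m : ℚ} (hm : m ≠ 0) (N : ℕ) :
    (∑ k ∈ range N, ((2 * k).choose k : ℚ) / m ^ k) * m ^ N = m * centralSum m N := by
  induction N with
  | zero => simp [centralSum]
  | succ N ih =>
    rw [sum_range_succ, centralSum, pow_succ, ← mul_assoc, add_mul, ih]
    field_simp

lemma choose_middle_recurrence (M : ℕ) :
    ((2 * (M + 1)).choose (M + 1) : ℚ) = 2 * ((2 * M + 1).choose M : ℚ) ∧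
    ((2 * (M + 1) + 1).choose (M + 1) : ℚ) =
      ((2 * (M + 1)).choose (M + 1 + 1) : ℚ) + ((2 * (M + 1)).choose (M + 1) : ℚ) := by
  constructor
  · have := choose_two_mul_succ_cast (A := ℚ) M 0
    simp only [add_zero, zero_add, choose_middle_eq] at this
    rw [this]; ring
  · rw [← choose_middle_eq, Nat.choose_succ_succ']
    push_cast; ring

/-- By Pascal's rule the increment of `C(2M+1, M)/m^M` is `C(2k, k+1)/m^k - (m-2)/2 · C(2k, k)/m^k`
with `k = M + 1`. -/
lemma sum_choose_succ_div {m : ℚ} (hm : m ≠ 0) (M : ℕ) :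
    ∑ k ∈ range (M + 1), ((2 * k).choose (k + 1) : ℚ) / m ^ k =
      (m - 2) / 2 * (∑ k ∈ range (M + 1), ((2 * k).choose k : ℚ) / m ^ k) - m / 2
        + ((2 * M + 1).choose M : ℚ) / m ^ M := by
  induction M with
  | zero => simp; ring
  | succ M ih =>
    obtain ⟨h1, h2⟩ := choose_middle_recurrence M
    rw [sum_range_succ, ih, sum_range_succ _ (M + 1), h2, h1]
    field_simp
    ring

lemma catalan_eq_choose_sub (k : ℕ) :
    (catalan k : ℚ) = ((2 * k).choose k : ℚ) - ((2 * k).choose (k + 1) : ℚ) := by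
  have h1 := succ_mul_catalan_eq_centralBinom k
  have h2 := Nat.choose_succ_right_eq (2 * k) k
  rw [show 2 * k - k = k by lia] at h2
  rw [Nat.centralBinom] at h1
  have h3 : (k + 1 : ℚ) ≠ 0 := by positivity
  have h1' := congrArg (Nat.cast (R := ℚ)) h1
  have h2' := congrArg (Nat.cast (R := ℚ)) h2
  push_cast at h1' h2'
  refine mul_left_cancel₀ h3 ?_
  linear_combination h1' + h2'

end RationalSums

/-! ### Congruences between rational numbers -/

section PadicModEq

variable {p : ℕ} [Fact p.Prime] {e : ℕ} {a b c d : ℚ}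

lemma PadicModEq.sub (h1 : PadicModEq p e a b) (h2 : PadicModEq p e c d) :
    PadicModEq p e (a - c) (b - d) := by
  obtain ⟨x, y, hx, hy, hxy⟩ := h1
  obtain ⟨z, w, hz, hw, hzw⟩ := h2
  exact ⟨x - z, y - w, by push_cast; rw [hx, hz], by push_cast; rw [hy, hw],
    by rw [sub_sub_sub_comm]; exact dvd_sub hxy hzw⟩

lemma PadicModEq.add (h1 : PadicModEq p e a b) (h2 : PadicModEq p e c d) :
    PadicModEq p e (a + c) (b + d) := by
  obtain ⟨x, y, hx, hy, hxy⟩ := h1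
  obtain ⟨z, w, hz, hw, hzw⟩ := h2
  exact ⟨x + z, y + w, by push_cast; rw [hx, hz], by push_cast; rw [hy, hw],
    by rw [add_sub_add_comm]; exact dvd_add hxy hzw⟩

lemma PadicInt.isUnit_intCast_of_not_dvd {j : ℤ} (h : ¬ (p : ℤ) ∣ j) : IsUnit (j : ℤ_[p]) := by
  rw [PadicInt.isUnit_iff]
  exact le_antisymm (PadicInt.norm_le_one _)
    (not_lt.1 fun h' => h ((PadicInt.norm_int_lt_one_iff_dvd _).1 h'))

lemma PadicInt.exists_coe_eq_div {u : ℤ_[p]} (hu : IsUnit u) (z : ℤ_[p]) :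
    ∃ w : ℤ_[p], w * u = z ∧ (w : ℚ_[p]) = z / u := by
  obtain ⟨v, hv⟩ := hu.dvd (a := z)
  refine ⟨v, by rw [hv, mul_comm], ?_⟩
  have hu0 : (u : ℚ_[p]) ≠ 0 := by
    rw [Ne, PadicInt.coe_eq_zero]
    exact hu.ne_zero
  rw [eq_div_iff hu0, hv]
  push_cast; ring

lemma PadicModEq.half_mul (hp : Odd p) (h : PadicModEq p e a b) (j : ℤ) :
    PadicModEq p e (j / 2 * a) (j / 2 * b) := by
  obtain ⟨x, y, hx, hy, hxy⟩ := h
  obtain ⟨w, -, hw⟩ := PadicInt.exists_coe_eq_div (PadicInt.isUnit_two hp) j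
  push_cast at hw
  have h2 : ((2 : ℤ_[p]) : ℚ_[p]) = 2 := rfl
  rw [h2] at hw
  exact ⟨w * x, w * y, by push_cast; rw [hx, hw], by push_cast; rw [hy, hw],
    by rw [← mul_sub]; exact hxy.mul_left _⟩

/-- Clears the denominator `n m^K`: `m` is a unit, but `n` need not be, hence the modulus `n p^e`.
-/
lemma padicModEq_of_mul_pow {m : ℤ} (hpm : ¬ (p : ℤ) ∣ m) {n K : ℕ} (hn : n ≠ 0) (A B : ℤ)
    (ha : a * (n * (m : ℚ) ^ K) = A) (hb : b * (m : ℚ) ^ K = B)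
    (h : (n : ℤ_[p]) * (p : ℤ_[p]) ^ e ∣ A - n * B) : PadicModEq p e a b := by
  obtain ⟨t, ht⟩ := h
  have hu := (PadicInt.isUnit_intCast_of_not_dvd hpm).pow K
  obtain ⟨y, hy1, hy⟩ := PadicInt.exists_coe_eq_div hu B
  obtain ⟨z, hz1, hz⟩ := PadicInt.exists_coe_eq_div hu (B + p ^ e * t)
  have hm : (m : ℚ_[p]) ≠ 0 := by
    have : m ≠ 0 := by rintro rfl; simp at hpm
    exact_mod_cast this
  have hn' : (n : ℚ_[p]) ≠ 0 := by exact_mod_cast hn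
  have ha' := congrArg (Rat.cast (K := ℚ_[p])) ha
  have hb' := congrArg (Rat.cast (K := ℚ_[p])) hb
  have ht' := congrArg (fun z : ℤ_[p] => (z : ℚ_[p])) ht
  push_cast at ha' hb' ht' hy hz
  refine ⟨z, y, ?_, ?_, hu.dvd_mul_right.1 ⟨t, ?_⟩⟩
  · rw [hz, div_eq_iff (pow_ne_zero _ hm)]
    refine mul_left_cancel₀ hn' ?_
    linear_combination -ht' - ha'
  · rw [hy, div_eq_iff (pow_ne_zero _ hm), hb']
  · linear_combination hz1 - hy1

end PadicModEq

/-! ### The Legendre symbol supplies the rank data -/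

section LegendreSymbol

variable {p : ℕ} [Fact p.Prime]

lemma prime_dvd_lucasIm_sub_legendreSym (hp : Odd p) (m : ℤ) :
    (p : ℤ_[p]) ∣ lucasIm ((m - 2 : ℤ) : ℤ_[p]) p - legendreSym p (m * (m - 4)) := by
  refine prime_dvd_lucasIm_sub hp ?_
  rw [show (((m - 2 : ℤ) : ℤ_[p]) ^ 2 - 4) = ((m * (m - 4) : ℤ) : ℤ_[p]) by push_cast; ring,
    PadicInt.prime_dvd_iff_toZMod, map_sub, map_pow, map_intCast, map_intCast,
    legendreSym.eq_pow, sub_self]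

lemma isLucasRank_legendreSym {m : ℤ} (hpm : ¬ (p : ℤ) ∣ m) :
    IsLucasRank ((m - 2 : ℤ) : ℤ_[p]) (legendreSym p (m * (m - 4)))
      ((p : ℤ) - legendreSym p (m * (m - 4))).toNat := by
  have hprime : p.Prime := Fact.out
  have hx : ((m - 2 : ℤ) : ℤ_[p]) - 2 = ((m - 4 : ℤ) : ℤ_[p]) := by push_cast; ring
  rw [IsLucasRank, hx]
  by_cases h : (p : ℤ) ∣ m - 4
  · have h0 : legendreSym p (m * (m - 4)) = 0 := by
      rw [legendreSym.eq_zero_iff, ZMod.intCast_zmod_eq_zero_iff_dvd]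
      exact h.mul_left _
    refine Or.inr (Or.inr ⟨by simp [h0], by simp [h0], ?_⟩)
    exact_mod_cast (Int.castRingHom ℤ_[p]).map_dvd h
  · have hu := PadicInt.isUnit_intCast_of_not_dvd h
    have h0 : ((m * (m - 4) : ℤ) : ZMod p) ≠ 0 := by
      rw [Ne, ZMod.intCast_zmod_eq_zero_iff_dvd, (Nat.prime_iff_prime_int.1 hprime).dvd_mul]
      tauto
    have := hprime.pos
    rcases legendreSym.eq_one_or_neg_one p h0 with h1 | h1 <;> rw [h1]
    · exact Or.inl ⟨by simp, by lia, hu⟩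
    · exact Or.inr (Or.inl ⟨by simp, by lia, hu⟩)

end LegendreSymbol

/-! ### The three congruences -/

theorem theorem1p1 (m : ℤ) (hm : m ≠ 0) (n : ℕ) (hn : 0 < n)
    (p : ℕ) [Fact p.Prime] (hp : Odd p) (hpm : ¬ (p : ℤ) ∣ m) (Δ : ℤ) (hΔ : Δ = m * (m - 4)) :
    PadicModEq p 2
      ((1 / (n : ℚ)) *
        ((∑ k ∈ Finset.range (p * n), ((2 * k).choose k : ℚ) / (m : ℚ) ^ k)
          - (legendreSym p Δ : ℚ) *
            ∑ r ∈ Finset.range n, ((2 * r).choose r : ℚ) / (m : ℚ) ^ r))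
      (((2 * n - 1).choose (n - 1) : ℚ) / (m : ℚ) ^ (n - 1) *
        (lucasU (m - 2) 1 ((p : ℤ) - legendreSym p Δ).toNat : ℚ))
    ∧ PadicModEq p 2
      ((1 / (n : ℚ)) *
        ((∑ k ∈ Finset.range (p * n), ((2 * k).choose (k + 1) : ℚ) / (m : ℚ) ^ k)
          - (legendreSym p Δ : ℚ) *
            (∑ r ∈ Finset.range n, ((2 * r).choose (r + 1) : ℚ) / (m : ℚ) ^ r)
          + ((m : ℚ) / 2 - ((2 * n - 1).choose (n - 1) : ℚ) / (m : ℚ) ^ (n - 1)) *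
            (1 - (legendreSym p Δ : ℚ))))
      (((2 * n - 1).choose (n - 1) : ℚ) / (m : ℚ) ^ (n - 1) *
        (1 - (m : ℚ) ^ (p - 1) + ((m : ℚ) - 2) / 2 *
          (lucasU (m - 2) 1 ((p : ℤ) - legendreSym p Δ).toNat : ℚ)))
    ∧ PadicModEq p 2
      ((1 / (n : ℚ)) *
        ((∑ k ∈ Finset.range (p * n), (catalan k : ℚ) / (m : ℚ) ^ k)
          - (legendreSym p Δ : ℚ) *
            (∑ r ∈ Finset.range n, (catalan r : ℚ) / (m : ℚ) ^ r)
          + (((2 * n - 1).choose (n - 1) : ℚ) / (m : ℚ) ^ (n - 1) - (m : ℚ) / 2) *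
            (1 - (legendreSym p Δ : ℚ))))
      (((2 * n - 1).choose (n - 1) : ℚ) / (m : ℚ) ^ (n - 1) *
        ((m : ℚ) ^ (p - 1) - 1 + (4 - (m : ℚ)) / 2 *
          (lucasU (m - 2) 1 ((p : ℤ) - legendreSym p Δ).toNat : ℚ))) := by
  have hprime : p.Prime := Fact.out
  obtain ⟨N, rfl⟩ : ∃ N, n = N + 1 := ⟨n - 1, by lia⟩
  subst hΔ
  rw [show 2 * (N + 1) - 1 = 2 * N + 1 by lia, show N + 1 - 1 = N by lia]
  have hx : ((m - 2 : ℤ) : ℤ_[p]) + 2 = m := by push_cast; ring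
  have hM := PadicInt.isUnit_intCast_of_not_dvd hpm
  have hmain := (isLucasRank_legendreSym hpm).dvd_centralSum_prime_mul hp (by rwa [hx])
    (prime_dvd_lucasIm_sub_legendreSym hp m) N
  rw [hx, ← lucasU_cast] at hmain
  set ε := legendreSym p (m * (m - 4))
  set U := lucasU (m - 2) 1 ((p : ℤ) - ε).toNat
  have hmq : (m : ℚ) ≠ 0 := by exact_mod_cast hm
  have hnq : ((N + 1 : ℕ) : ℚ) ≠ 0 := by positivity
  obtain ⟨R, hR⟩ : ∃ R, p * (N + 1) = R + 1 :=
    ⟨p * (N + 1) - 1, by have : 0 < p * (N + 1) := Nat.mul_pos hprime.pos hn; lia⟩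
  -- Splitting `m^(pn-1) = m^((p-1)n) m^(n-1)` is what removes the power of `m` in the integral
  -- congruence.
  have hRN : (p - 1) * (N + 1) + N = R := by
    have : (p - 1) * (N + 1) + (N + 1) = p * (N + 1) := by
      rw [← add_one_mul, Nat.sub_add_cancel hprime.one_le]
    lia
  have h5 : PadicModEq p 2
      ((1 / ((N + 1 : ℕ) : ℚ)) *
        ((∑ k ∈ Finset.range (p * (N + 1)), ((2 * k).choose k : ℚ) / (m : ℚ) ^ k)
          - (ε : ℚ) * ∑ r ∈ Finset.range (N + 1), ((2 * r).choose r : ℚ) / (m : ℚ) ^ r))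
      (((2 * N + 1).choose N : ℚ) / (m : ℚ) ^ N * (U : ℚ)) := by
    refine padicModEq_of_mul_pow hpm (K := R) N.succ_ne_zero
      (centralSum m (p * (N + 1)) - m ^ ((p - 1) * (N + 1)) * (ε * centralSum m (N + 1)))
      (m ^ ((p - 1) * (N + 1)) * (((2 * N + 1).choose N : ℤ) * U)) ?_ ?_ ?_
    · have h1 := sum_centralBinom_div_mul_pow hmq (p * (N + 1))
      have h2 := sum_centralBinom_div_mul_pow hmq (N + 1)
      push_cast [centralSum_cast]
      rw [one_div, mul_comm (_⁻¹), mul_assoc, inv_mul_cancel_left₀ (by exact_mod_cast hnq)]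
      refine mul_left_cancel₀ hmq ?_
      rw [congrArg (fun i => (m : ℚ) ^ i) hR] at h1
      rw [← hRN] at h1 ⊢
      linear_combination h1 - ε * m ^ ((p - 1) * (N + 1)) * h2
    · push_cast
      rw [← hRN, pow_add]
      field_simp
    · refine hmain.trans (dvd_of_eq ?_)
      push_cast [centralSum_cast]
      ring
  -- The boundary terms of the telescoped sums: here `2 C(2R+1, R) = C(2pn, pn)`, and the ratio of
  -- the powers of `m` contributes `1 - m^(p-1)` after division by `n`.
  have hc : PadicModEq p 2
      ((1 / ((N + 1 : ℕ) : ℚ)) * (((2 * R + 1).choose R : ℚ) / (m : ℚ) ^ R -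
        ((2 * N + 1).choose N : ℚ) / (m : ℚ) ^ N))
      (((2 * N + 1).choose N : ℚ) / (m : ℚ) ^ N * (1 - (m : ℚ) ^ (p - 1))) := by
    refine padicModEq_of_mul_pow hpm (K := R) N.succ_ne_zero
      ((2 * R + 1).choose R - m ^ ((p - 1) * (N + 1)) * (2 * N + 1).choose N)
      (m ^ ((p - 1) * (N + 1)) * (((2 * N + 1).choose N : ℤ) * (1 - m ^ (p - 1)))) ?_ ?_ ?_
    · push_cast
      rw [← hRN, pow_add]
      field_simp
    · push_cast
      rw [← hRN, pow_add]
      field_simp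
    · obtain ⟨t, ht⟩ := exists_choose_prime_mul hp N
      obtain ⟨q, s, hq, hs⟩ := exists_pow_prime_sub_one_mul hp hM (N + 1)
      have h1 := choose_two_mul_succ_cast (A := ℤ_[p]) N 0
      have h2 := choose_two_mul_succ_cast (A := ℤ_[p]) R 0
      simp only [add_zero, zero_add, choose_middle_eq] at h1 h2
      rw [hR, h1, h2] at ht
      rw [← (PadicInt.isUnit_two hp).dvd_mul_left]
      push_cast at ht hs ⊢
      rw [hs, hq]
      exact ⟨t - 2 * ((2 * N + 1).choose N : ℤ_[p]) * (s - (N + 1) * q * (q + p * s)), by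
        linear_combination ht⟩
  have h6 : PadicModEq p 2
      ((1 / ((N + 1 : ℕ) : ℚ)) *
        ((∑ k ∈ Finset.range (p * (N + 1)), ((2 * k).choose (k + 1) : ℚ) / (m : ℚ) ^ k)
          - (ε : ℚ) * (∑ r ∈ Finset.range (N + 1), ((2 * r).choose (r + 1) : ℚ) / (m : ℚ) ^ r)
          + ((m : ℚ) / 2 - ((2 * N + 1).choose N : ℚ) / (m : ℚ) ^ N) * (1 - (ε : ℚ))))
      (((2 * N + 1).choose N : ℚ) / (m : ℚ) ^ N *
        (1 - (m : ℚ) ^ (p - 1) + ((m : ℚ) - 2) / 2 * (U : ℚ))) := by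
    convert (h5.half_mul hp (m - 2)).add hc using 1
    · rw [sum_choose_succ_div hmq, hR, sum_choose_succ_div hmq]
      push_cast; ring
    · push_cast; ring
  refine ⟨h5, h6, ?_⟩
  convert h5.sub h6 using 1
  · simp only [catalan_eq_choose_sub, sub_div, sum_sub_distrib]
    ring
  · ring
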